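/- Let $(X,d)$ be a complete metric space equipped with a Borel regular outer measure $\mu$ that is doubling, i.e. there is $c_d>0$ with $0<\mu(B(x,2r))\le c_d\,\mu(B(x,r))<\infty$ for every open ball $B(x,r)$, $x\in X$, $r>0$. A Borel function $g\ge 0$ with values in $[0,\infty]$ is an upper gradient of a function $u$ in an open set $U\subset X$ if $|u(x)-u(y)|\le\int_\gamma g\,ds$ for every rectifiable curve $\gamma$ in $U$ with end points $x,y$. Assume that $X$ supports a $(1,1)$-Poincaré inequality: there are $c_P>0$ and $\lambda\ge1$ such that $$\frac1{\mu(B(x,r))}\int_{B(x,r)}|u-u_{B(x,r)}|\,d\mu\le \frac{c_P\,r}{\mu(B(x,\lambda r))}\int_{B(x,\lambda r)}g\,d\mu$$ for every ball $B(x,r)$, every locally integrable $u$ on $X$ and every upper gradient $g$ of $u$ in $X$, where $u_{B}$ is the mean value of $u$ over $B$. For an open set $U\subset X$ write $V\Subset U$ if $V$ is open and $\overline V$ is a compact subset of $U$. Let $N^{1,1}(U)$ be the set of functions in $L^1(U)$ that have an upper gradient in $U$ belonging to $L^1(U)$; membership in $N^{1,1}_{\mathrm{loc}}(U)$ and convergence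 in $L^1_{\mathrm{loc}}(U)$ mean membership in $N^{1,1}(V)$ and convergence in $L^1(V)$ for every $V\Subset U$. Put $$\|Du\|(U)=\inf\Big\{\liminf_{i\to\infty}\int_U g_i\,d\mu:\ u_i\in N^{1,1}_{\mathrm{loc}}(U),\ u_i\to u\text{ in }L^1_{\mathrm{loc}}(U),\ g_i\text{ an upper gradient of }u_i\text{ in }U\Big\},$$ and $\|Du\|(A)=\inf\{\|Du\|(U): U\supset A\text{ open}\}$ for arbitrary $A\subset X$. Let $BV(X)$ be the set of $u\in L^1(X)$ with $\|Du\|(X)<\infty$, and for $\Omega\subset X$ open let $BV_0(\Omega)$ be the set of $g\in BV(X)$ with $g=0$ $\mu$-a.e. in $X\setminus\Omega$. Given $f\in BV(X)$, a function $u\in BV(X)$ is a solution to the Dirichlet problem for least gradients in $\Omega$ with boundary data $f$ if $u-f\in BV_0(\Omega)$ and $\|Du\|(\overline\Omega)\le\|D(u+g)\|(\overline\Omega)$ for every $g\in BV_0(\Omega)$. **Theorem.** Let $M\in\mathbb R$, let $f\in BV(X)$ satisfy $f\le M$ $\mu$-a.e. on $X$, and let $\Omega\subset X$ be a domain (a nonempty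 connected open set) with $\mu(X\setminus\Omega)>0$. If $u\in BV(X)$ is a solution to the Dirichlet problem for least gradients in $\Omega$ with boundary data $f$, then $u\le M$ $\mu$-a.e. in $\Omega$. -/

import Mathlib

open MeasureTheory Filter Topology Set
open scoped ENNReal NNReal

namespace LeastGradient

variable {X : Type*} [MetricSpace X] [MeasurableSpace X]

/-- The measure is doubling: `0 < μ(B(x,2r)) ≤ c μ(B(x,r)) < ∞` for all open balls. -/
def IsDoubling (μ : Measure X) : Prop :=
  ∃ c : ℝ≥0, 0 < c ∧ ∀ (x : X) (r : ℝ), 0 < r →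
    0 < μ (Metric.ball x (2 * r)) ∧
    μ (Metric.ball x (2 * r)) ≤ c * μ (Metric.ball x r) ∧
    μ (Metric.ball x r) < ∞

/-- `V ⋐ U`: the set `V` is open and its closure is a compact subset of `U`. -/
def CompactlyContained (V U : Set X) : Prop :=
  IsOpen V ∧ IsCompact (closure V) ∧ closure V ⊆ U

/-- The Borel function `g : X → [0,∞]` is an upper gradient of `u` in `U`: for every rectifiable
curve `γ` in `U` with end points `x, y` one has `|u x - u y| ≤ ∫_γ g ds`.
Rectifiable curves are taken in their arc-length parametrization `γ : [0, ℓ] → U`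
(`HasUnitSpeedOn`: the length of `γ` on `[s, t]` is `t - s`), which is the parametrization that
defines the line integral `∫_γ g ds = ∫_0^ℓ g (γ t) dt`. Functions are finite everywhere. -/
def IsUpperGradientOn (g : X → ℝ≥0∞) (u : X → ℝ) (U : Set X) : Prop :=
  Measurable g ∧
  ∀ (ℓ : ℝ) (γ : ℝ → X), 0 ≤ ℓ → HasUnitSpeedOn γ (Icc 0 ℓ) → MapsTo γ (Icc 0 ℓ) U →
    ENNReal.ofReal |u (γ 0) - u (γ ℓ)| ≤ ∫⁻ t in Icc 0 ℓ, g (γ t)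

/-- The `(1,1)`-Poincaré inequality:
`⨍_{B(x,r)} |u - u_{B(x,r)}| dμ ≤ c r ⨍_{B(x,λr)} g dμ` for all balls, all locally integrable `u`
and all upper gradients `g` of `u`. -/
def SupportsPoincare (μ : Measure X) : Prop :=
  ∃ c lam : ℝ, 0 < c ∧ 1 ≤ lam ∧
    ∀ (x : X) (r : ℝ), 0 < r → ∀ (u : X → ℝ) (g : X → ℝ≥0∞),
      LocallyIntegrable u μ → IsUpperGradientOn g u univ →
      ⨍⁻ y in Metric.ball x r, ENNReal.ofReal |u y - ⨍ z in Metric.ball x r, u z ∂μ| ∂μ ≤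
        ENNReal.ofReal (c * r) * ⨍⁻ y in Metric.ball x (lam * r), g y ∂μ

/-- `u` belongs to the Newton-Sobolev space `N^{1,1}(U)`. -/
def MemNewtonian (μ : Measure X) (u : X → ℝ) (U : Set X) : Prop :=
  IntegrableOn u U μ ∧
  ∃ g : X → ℝ≥0∞, IsUpperGradientOn g u U ∧ ∫⁻ x in U, g x ∂μ < ∞

/-- `u` belongs to `N^{1,1}_loc(U)`, that is, to `N^{1,1}(V)` for every `V ⋐ U`. -/
def MemNewtonianLoc (μ : Measure X) (u : X → ℝ) (U : Set X) : Prop :=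
  ∀ V, CompactlyContained V U → MemNewtonian μ u V

/-- `v i → u` in `L^1_loc(U)`, that is, in `L^1(V)` for every `V ⋐ U`. -/
def TendstoL1Loc (μ : Measure X) (v : ℕ → X → ℝ) (u : X → ℝ) (U : Set X) : Prop :=
  ∀ V, CompactlyContained V U →
    Tendsto (fun i => ∫⁻ x in V, ENNReal.ofReal |v i x - u x| ∂μ) atTop (𝓝 0)

/-- The total variation `‖Du‖(U)` in an open set `U`: the infimum of `liminf ∫_U g_i dμ` over all
sequences `v i ∈ N^{1,1}_loc(U)` converging to `u` in `L^1_loc(U)`, where `g i` is an upper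
gradient of `v i` in `U`. -/
noncomputable def variationOpen (μ : Measure X) (u : X → ℝ) (U : Set X) : ℝ≥0∞ :=
  ⨅ (v : ℕ → X → ℝ) (g : ℕ → X → ℝ≥0∞)
    (_ : ∀ i, MemNewtonianLoc μ (v i) U ∧ IsUpperGradientOn (g i) (v i) U)
    (_ : TendstoL1Loc μ v u U),
    liminf (fun i => ∫⁻ x in U, g i x ∂μ) atTop

/-- The total variation `‖Du‖(A)` of an arbitrary set `A`: the infimum of `‖Du‖(U)` over the open
sets `U ⊇ A`. -/
noncomputable def variation (μ : Measure X) (u : X → ℝ) (A : Set X) : ℝ≥0∞ :=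
  ⨅ (U : Set X) (_ : IsOpen U) (_ : A ⊆ U), variationOpen μ u U

/-- `u ∈ BV(X)`. -/
def MemBV (μ : Measure X) (u : X → ℝ) : Prop :=
  Integrable u μ ∧ variation μ u univ < ∞

/-- `g ∈ BV_0(Ω)`: a function in `BV(X)` that vanishes a.e. in `X \ Ω`. -/
def MemBVZero (μ : Measure X) (g : X → ℝ) (Ω : Set X) : Prop :=
  MemBV μ g ∧ ∀ᵐ x ∂μ, x ∉ Ω → g x = 0

/-- `u` is a solution to the Dirichlet problem for least gradients in `Ω` with boundary data
`f`. -/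
def IsDirichletSolution (μ : Measure X) (Ω : Set X) (f u : X → ℝ) : Prop :=
  MemBV μ u ∧ MemBVZero μ (fun x => u x - f x) Ω ∧
  ∀ g : X → ℝ, MemBVZero μ g Ω →
    variation μ u (closure Ω) ≤ variation μ (fun x => u x + g x) (closure Ω)

end LeastGradient

namespace LeastGradient

/-! ### Functions of one real variable controlled by the integral of a density -/

/-! Put `w = (u - M)₊`, so that `u - w = min(u, M)`. Since `f ≤ M`, `w` belongs to `BV_0(Ω)` and
`min(u, M)` is an admissible competitor. Cutting at level `M` splits the variation: `‖D min(u, M)‖ +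
‖Dw‖ ≤ ‖Du‖` on every set (`variation_min_add_max_le`). Minimality gives `‖Du‖ ≤ ‖D min(u, M)‖` on
the closure of `Ω`, hence `‖Dw‖(closure Ω) = 0`.

The splitting holds because an upper gradient of a function may be discarded where that function is
above the level (for the minimum) or below it (for the positive part); each density is then counted
at most once. Along a curve this is a statement about one real variable, proved by gluing over the
closed set of times at which the truncation is constant.

It remains to see that `w = 0`. Good approximants of `w` live only on a neighbourhood of the closure
of `Ω`, while the Poincaré inequality needs functions on all of `X`. They are multiplied by a cutoff
(`IsUpperGradientOn.cutoff`) whose slope acts only off the closure of `Ω`, as seen inside a large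
ball; there `w = 0`, so the approximants are small in `L^1`. Hence `w` is arbitrarily close to
constants on each ball (`exists_lintegral_sub_const_le`), and a ball that meets the complement of
`Ω` in positive measure forces the constants to tend to `0`. -/

lemma setLIntegral_Icc_add {a b c : ℝ} (hab : a ≤ b) (hbc : b ≤ c) (G : ℝ → ℝ≥0∞) :
    ∫⁻ t in Icc a c, G t = (∫⁻ t in Icc a b, G t) + ∫⁻ t in Icc b c, G t := by
  rw [← Icc_union_Ioc_eq_Icc hab hbc, lintegral_union measurableSet_Ioc,
    restrict_Ioc_eq_restrict_Icc]
  exact Set.disjoint_left.2 fun t ht ht' => not_lt.2 ht.2 ht'.1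

lemma ofReal_abs_sub_le_add {x y z : ℝ} {A B : ℝ≥0∞} (h₁ : ENNReal.ofReal |x - y| ≤ A)
    (h₂ : ENNReal.ofReal |y - z| ≤ B) : ENNReal.ofReal |x - z| ≤ A + B :=
  calc ENNReal.ofReal |x - z| ≤ ENNReal.ofReal (|x - y| + |y - z|) :=
        ENNReal.ofReal_le_ofReal (abs_sub_le x y z)
    _ = ENNReal.ofReal |x - y| + ENNReal.ofReal |y - z| :=
        ENNReal.ofReal_add (abs_nonneg _) (abs_nonneg _)
    _ ≤ A + B := add_le_add h₁ h₂

/-- The oscillation of `w` between any two points of `[a, b]` is at most the integral of `G`. -/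
def IsControlledOn (w : ℝ → ℝ) (G : ℝ → ℝ≥0∞) (a b : ℝ) : Prop :=
  ∀ s t, a ≤ s → s ≤ t → t ≤ b → ENNReal.ofReal |w s - w t| ≤ ∫⁻ τ in Icc s t, G τ

lemma IsControlledOn.mono {w : ℝ → ℝ} {G : ℝ → ℝ≥0∞} {a b a' b' : ℝ} (h : IsControlledOn w G a b)
    (ha : a ≤ a') (hb : b' ≤ b) : IsControlledOn w G a' b' :=
  fun s t hs hst ht => h s t (ha.trans hs) hst (ht.trans hb)

/-- Gluing along a closed set `F` of times: it suffices to compare two points of `F`, and the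
end points of intervals whose interior avoids `F`. -/
lemma ofReal_abs_sub_le_of_isClosed {w : ℝ → ℝ} {G : ℝ → ℝ≥0∞} {a b : ℝ} {F : Set ℝ} (hab : a ≤ b)
    (hF : IsClosed (F ∩ Icc a b))
    (h₁ : ∀ s ∈ F ∩ Icc a b, ∀ t ∈ F ∩ Icc a b, s ≤ t →
      ENNReal.ofReal |w s - w t| ≤ ∫⁻ τ in Icc s t, G τ)
    (h₂ : ∀ s t, a ≤ s → s ≤ t → t ≤ b → (∀ τ ∈ Ioo s t, τ ∉ F) →
      ENNReal.ofReal |w s - w t| ≤ ∫⁻ τ in Icc s t, G τ) :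
    ENNReal.ofReal |w a - w b| ≤ ∫⁻ τ in Icc a b, G τ := by
  rcases (F ∩ Icc a b).eq_empty_or_nonempty with he | hne
  · refine h₂ a b le_rfl hab le_rfl fun τ hτ hF' => ?_
    have : τ ∈ F ∩ Icc a b := ⟨hF', hτ.1.le, hτ.2.le⟩
    simp [he] at this
  have hc : IsCompact (F ∩ Icc a b) := isCompact_Icc.of_isClosed_subset hF inter_subset_right
  obtain ⟨p, hp, hpmin⟩ := hc.exists_isLeast hne
  obtain ⟨q, hq, hqmax⟩ := hc.exists_isGreatest hne
  have hpq : p ≤ q := hpmin hq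
  rw [setLIntegral_Icc_add hp.2.1 (hpq.trans hq.2.2), setLIntegral_Icc_add hpq hq.2.2]
  refine ofReal_abs_sub_le_add (y := w p) ?_ (ofReal_abs_sub_le_add (h₁ p hp q hq hpq) ?_)
  · refine h₂ a p le_rfl hp.2.1 hp.2.2 fun τ hτ hF' => ?_
    exact not_le.2 hτ.2 (hpmin ⟨hF', hτ.1.le, hτ.2.le.trans hp.2.2⟩)
  · refine h₂ q b hq.2.1 hq.2.2 le_rfl fun τ hτ hF' => ?_
    exact not_le.2 hτ.1 (hqmax ⟨hF', hq.2.1.trans hτ.1.le, hτ.2.le⟩)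

/-- Cut `[a, b]` into pieces of length at most `δ`: the integral is additive and the oscillation
subadditive. -/
lemma ofReal_abs_sub_le_of_short {w : ℝ → ℝ} {G : ℝ → ℝ≥0∞} {a b δ : ℝ} (hab : a ≤ b) (hδ : 0 < δ)
    (h : ∀ s t, a ≤ s → s ≤ t → t ≤ b → t - s ≤ δ →
      ENNReal.ofReal |w s - w t| ≤ ∫⁻ τ in Icc s t, G τ) :
    ENNReal.ofReal |w a - w b| ≤ ∫⁻ τ in Icc a b, G τ := by
  have key : ∀ n : ℕ, ∀ t, a ≤ t → t ≤ b → t - a ≤ n * δ →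
      ENNReal.ofReal |w a - w t| ≤ ∫⁻ τ in Icc a t, G τ := by
    intro n
    induction n with
    | zero =>
      intro t hat _ ht
      have : t = a := by simp at ht; linarith
      simp [this]
    | succ n ih =>
      intro t hat htb ht
      push_cast at ht
      have hm : max a (t - δ) ≤ t := max_le hat (by linarith)
      rw [setLIntegral_Icc_add (le_max_left a (t - δ)) hm]
      refine ofReal_abs_sub_le_add (ih _ (le_max_left _ _) (hm.trans htb) ?_)
        (h _ _ (le_max_left _ _) hm htb ?_)
      · rcases max_cases a (t - δ) with h' | h' <;> rw [h'.1]
        · simp; positivity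
        · linarith
      · linarith [le_max_right a (t - δ)]
  obtain ⟨n, hn⟩ := exists_nat_ge ((b - a) / δ)
  exact key n b hab le_rfl (by rwa [div_le_iff₀ hδ] at hn)

/-- Absolute continuity of the integral. It makes the set of times where `w ≥ M` closed, as the
gluing lemma requires. -/
lemma IsControlledOn.continuousOn {w : ℝ → ℝ} {G : ℝ → ℝ≥0∞} {a b : ℝ} (h : IsControlledOn w G a b)
    (hG : ∫⁻ τ in Icc a b, G τ ≠ ∞) : ContinuousOn w (Icc a b) := by
  rw [Metric.continuousOn_iff]
  intro t ht ε hε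
  obtain ⟨δ, hδ, H⟩ := exists_pos_setLIntegral_lt_of_measure_lt hG
    (ENNReal.ofReal_pos.2 hε).ne'
  obtain ⟨δ', hδ', hlt⟩ := ENNReal.lt_iff_exists_nnreal_btwn.1 hδ
  have hpos : (0 : ℝ) < δ' := by exact_mod_cast hδ'
  have main : ∀ s t, s ∈ Icc a b → t ∈ Icc a b → s ≤ t → t - s < δ' → |w s - w t| < ε := by
    intro s t hs ht hst hd
    refine (ENNReal.ofReal_lt_ofReal_iff hε).1 ((h s t hs.1 hst ht.2).trans_lt ?_)
    have hsub : Icc s t ⊆ Icc a b := Icc_subset_Icc hs.1 ht.2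
    have := H (Icc s t) ?_
    · rwa [Measure.restrict_restrict measurableSet_Icc, inter_eq_left.2 hsub] at this
    · refine (Measure.restrict_apply_le _ _).trans_lt (lt_of_lt_of_le ?_ hlt.le)
      rw [Real.volume_Icc, ← ENNReal.ofReal_coe_nnreal]
      exact (ENNReal.ofReal_lt_ofReal_iff hpos).2 hd
  refine ⟨δ', hpos, fun s hs hd => ?_⟩
  rw [Real.dist_eq] at hd ⊢
  rcases le_total s t with hst | hst
  · exact main s t hs ht hst (by rw [abs_sub_comm] at hd; exact (le_abs_self _).trans_lt hd)
  · rw [abs_sub_comm]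
    exact main t s ht hs hst ((le_abs_self _).trans_lt hd)

lemma setLIntegral_Icc_mono {G H : ℝ → ℝ≥0∞} {s t : ℝ} (h : ∀ τ ∈ Ioo s t, G τ ≤ H τ) :
    ∫⁻ τ in Icc s t, G τ ≤ ∫⁻ τ in Icc s t, H τ := by
  rw [← restrict_Ioo_eq_restrict_Icc]
  exact setLIntegral_mono' measurableSet_Ioo h

/-- Truncating from above only costs the density on the set where the function is below the
level. -/
lemma IsControlledOn.min_const {w : ℝ → ℝ} {G H : ℝ → ℝ≥0∞} {a b M : ℝ} (hab : a ≤ b)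
    (h : IsControlledOn w G a b) (hG : ∫⁻ τ in Icc a b, G τ ≠ ∞)
    (hH : ∀ τ ∈ Icc a b, w τ < M → G τ ≤ H τ) :
    ENNReal.ofReal |min (w a) M - min (w b) M| ≤ ∫⁻ τ in Icc a b, H τ := by
  -- Between two times in `F` the truncation takes the same value `M`; on a gap of `F` one has `w <
  -- M`, so `H` dominates `G` there.
  refine ofReal_abs_sub_le_of_isClosed (w := fun τ => min (w τ) M) (F := {τ | M ≤ w τ}) hab ?_ ?_ ?_
  · rw [inter_comm]
    exact (h.continuousOn hG).preimage_isClosed_of_isClosed isClosed_Icc isClosed_Ici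
  · intro s hs t ht _
    simp [min_eq_right (show M ≤ w s from hs.1), min_eq_right (show M ≤ w t from ht.1)]
  · intro s t hs hst ht hF
    refine le_trans (ENNReal.ofReal_le_ofReal ?_) ((h s t hs hst ht).trans
      (setLIntegral_Icc_mono fun τ hτ => hH τ ⟨hs.trans hτ.1.le, hτ.2.le.trans ht⟩
        (not_le.1 (hF τ hτ))))
    exact (abs_min_sub_min_le_max _ _ _ _).trans (by simp)

/-- A product rule with a bounded Lipschitz factor. -/
lemma IsControlledOn.mul_lipschitz {v h : ℝ → ℝ} {G A : ℝ → ℝ≥0∞} {a b δ : ℝ} (hab : a ≤ b)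
    (hδ : 0 < δ) (hv : IsControlledOn v G a b)
    (h01 : ∀ τ, |h τ| ≤ 1)
    (hlip : ∀ s t, a ≤ s → s ≤ t → t ≤ b → |h s - h t| ≤ δ⁻¹ * (t - s))
    (hA : ∀ τ ∈ Ioo a b, ENNReal.ofReal |v τ| ≤ A τ) :
    ENNReal.ofReal |h a * v a - h b * v b| ≤
      ∫⁻ τ in Icc a b, (2 * G τ + ENNReal.ofReal δ⁻¹ * A τ) := by
  -- On intervals of length at most `δ`, replacing `v t` by `v τ` in the term with the slope of `h`
  -- costs at most `δ⁻¹ (t - s) I ≤ I`. This is the second copy of `G` in the bound.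
  refine ofReal_abs_sub_le_of_short (w := fun τ => h τ * v τ) hab hδ fun s t hs hst ht hd => ?_
  set I := ∫⁻ τ in Icc s t, G τ with hI
  have e1 : ENNReal.ofReal (|v t| * (δ⁻¹ * (t - s))) ≤
      (∫⁻ τ in Icc s t, ENNReal.ofReal δ⁻¹ * A τ) + I :=
    calc ENNReal.ofReal (|v t| * (δ⁻¹ * (t - s)))
        = ∫⁻ τ in Icc s t, ENNReal.ofReal δ⁻¹ * ENNReal.ofReal |v t| := by
          rw [setLIntegral_const, Real.volume_Icc, ← ENNReal.ofReal_mul (by positivity),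
            ← ENNReal.ofReal_mul (by positivity)]
          ring_nf
      _ ≤ ∫⁻ τ in Icc s t, (ENNReal.ofReal δ⁻¹ * A τ + ENNReal.ofReal δ⁻¹ * I) := by
          refine setLIntegral_Icc_mono fun τ hτ => ?_
          rw [← mul_add]
          gcongr
          calc ENNReal.ofReal |v t| ≤ ENNReal.ofReal (|v τ| + |v τ - v t|) := by
                refine ENNReal.ofReal_le_ofReal ?_
                have := abs_sub_abs_le_abs_sub (v t) (v τ)
                rw [abs_sub_comm] at this
                linarith
            _ = ENNReal.ofReal |v τ| + ENNReal.ofReal |v τ - v t| :=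
                ENNReal.ofReal_add (abs_nonneg _) (abs_nonneg _)
            _ ≤ A τ + I := by
                refine add_le_add (hA τ ⟨hs.trans_lt hτ.1, hτ.2.trans_le ht⟩)
                  ((hv τ t (hs.trans hτ.1.le) hτ.2.le ht).trans ?_)
                exact lintegral_mono_set (Icc_subset_Icc hτ.1.le le_rfl)
      _ = (∫⁻ τ in Icc s t, ENNReal.ofReal δ⁻¹ * A τ) +
            ENNReal.ofReal (δ⁻¹ * (t - s)) * I := by
          rw [lintegral_add_right _ measurable_const, setLIntegral_const, Real.volume_Icc,
            ENNReal.ofReal_mul (by positivity)]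
          ring
      _ ≤ (∫⁻ τ in Icc s t, ENNReal.ofReal δ⁻¹ * A τ) + 1 * I := by
          gcongr
          refine ENNReal.ofReal_le_one.2 ?_
          rw [inv_mul_le_iff₀ hδ]
          linarith
      _ = _ := by rw [one_mul]
  calc ENNReal.ofReal |h s * v s - h t * v t|
      ≤ ENNReal.ofReal (|v s - v t| + |v t| * (δ⁻¹ * (t - s))) := by
        refine ENNReal.ofReal_le_ofReal ?_
        have : h s * v s - h t * v t = h s * (v s - v t) + v t * (h s - h t) := by ring
        rw [this]
        refine (abs_add_le _ _).trans (add_le_add ?_ ?_)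
        · rw [abs_mul]
          exact mul_le_of_le_one_left (abs_nonneg _) (h01 s)
        · rw [abs_mul]
          exact mul_le_mul_of_nonneg_left (hlip s t hs hst ht) (abs_nonneg _)
    _ ≤ I + ((∫⁻ τ in Icc s t, ENNReal.ofReal δ⁻¹ * A τ) + I) := by
        rw [ENNReal.ofReal_add (abs_nonneg _)
          (mul_nonneg (abs_nonneg _) (mul_nonneg (by positivity) (by linarith)))]
        exact add_le_add (hv s t hs hst ht) e1
    _ = 2 * I + ∫⁻ τ in Icc s t, ENNReal.ofReal δ⁻¹ * A τ := by ring
    _ = (∫⁻ τ in Icc s t, 2 * G τ) + ∫⁻ τ in Icc s t, ENNReal.ofReal δ⁻¹ * A τ := by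
        rw [lintegral_const_mul' 2 _ (by norm_num)]
    -- Superadditivity of the integral needs no measurability of `G` or `A`.
    _ ≤ _ := le_lintegral_add _ _

/-! ### Curves and upper gradients -/

variable {X : Type*} [MetricSpace X] [MeasurableSpace X]

lemma dist_le_of_hasUnitSpeedOn {X : Type*} [MetricSpace X] {γ : ℝ → X} {I : Set ℝ} (h : HasUnitSpeedOn γ I) {s t : ℝ}
    (hs : s ∈ I) (ht : t ∈ I) (hst : s ≤ t) : dist (γ s) (γ t) ≤ t - s := by
  have h1 : edist (γ s) (γ t) ≤ eVariationOn γ (I ∩ Icc s t) :=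
    eVariationOn.edist_le γ ⟨hs, le_rfl, hst⟩ ⟨ht, hst, le_rfl⟩
  rw [h hs ht, edist_dist] at h1
  have := (ENNReal.ofReal_le_ofReal_iff (by simpa using hst)).1 h1
  simpa using this

lemma continuousOn_of_hasUnitSpeedOn {X : Type*} [MetricSpace X] {γ : ℝ → X} {I : Set ℝ} (h : HasUnitSpeedOn γ I) :
    ContinuousOn γ I := by
  refine LipschitzOnWith.continuousOn (K := 1) (LipschitzOnWith.of_dist_le_mul fun s hs t ht => ?_)
  rw [NNReal.coe_one, one_mul, Real.dist_eq]
  rcases le_total s t with hst | hst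
  · rw [abs_sub_comm]
    exact (dist_le_of_hasUnitSpeedOn h hs ht hst).trans (le_abs_self _)
  · rw [dist_comm]
    exact (dist_le_of_hasUnitSpeedOn h ht hs hst).trans (le_abs_self _)

lemma hasUnitSpeedOn_comp_add {X : Type*} [MetricSpace X] {γ : ℝ → X} {ℓ s t : ℝ} (h : HasUnitSpeedOn γ (Icc 0 ℓ))
    (hs : 0 ≤ s) (ht : t ≤ ℓ) : HasUnitSpeedOn (fun τ => γ (τ + s)) (Icc 0 (t - s)) := by
  intro x hx y hy
  have hx' : x + s ∈ Icc 0 ℓ := ⟨by linarith [hx.1], by linarith [hx.2]⟩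
  have hy' : y + s ∈ Icc 0 ℓ := ⟨by linarith [hy.1], by linarith [hy.2]⟩
  have hmono : MonotoneOn (fun τ : ℝ => τ + s) (Icc 0 (t - s) ∩ Icc x y) :=
    fun a _ b _ hab => by simpa using hab
  have := eVariationOn.comp_eq_of_monotoneOn γ (fun τ : ℝ => τ + s) hmono
  have himg : (fun τ : ℝ => τ + s) '' (Icc 0 (t - s) ∩ Icc x y) = Icc 0 ℓ ∩ Icc (x + s) (y + s) := by
    rw [inter_eq_right.2 (Icc_subset_Icc hx.1 hy.2),
      inter_eq_right.2 (Icc_subset_Icc hx'.1 hy'.2), image_add_const_Icc]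
  rw [himg, h hx' hy'] at this
  have h2 : (y + s) - (x + s) = y - x := by ring
  rw [h2] at this
  exact this

lemma setLIntegral_Icc_comp_add (G : ℝ → ℝ≥0∞) (s t : ℝ) :
    ∫⁻ τ in Icc 0 (t - s), G (τ + s) = ∫⁻ τ in Icc s t, G τ := by
  have := (measurePreserving_add_right (volume : Measure ℝ) s).setLIntegral_comp_preimage_emb
    (measurableEmbedding_addRight s) G (Icc s t)
  simpa using this

/-- A subarc, shifted to start at time `0`, is again an arc-length parametrized curve; only the
subarc has to stay in `U`. -/
lemma IsUpperGradientOn.isControlledOn {g : X → ℝ≥0∞} {u : X → ℝ} {U : Set X}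
    (hg : IsUpperGradientOn g u U) {γ : ℝ → X} {ℓ a b : ℝ} (hγ : HasUnitSpeedOn γ (Icc 0 ℓ))
    (ha : 0 ≤ a) (hb : b ≤ ℓ) (hU : MapsTo γ (Icc a b) U) :
    IsControlledOn (fun τ => u (γ τ)) (fun τ => g (γ τ)) a b := by
  intro s t hs hst ht
  have := hg.2 (t - s) (fun τ => γ (τ + s)) (by linarith)
    (hasUnitSpeedOn_comp_add hγ (ha.trans hs) (ht.trans hb))
    fun τ hτ => hU ⟨by linarith [hτ.1], by linarith [hτ.2]⟩
  rw [setLIntegral_Icc_comp_add (fun τ => g (γ τ))] at this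
  simpa using this

/-- Truncation of upper gradients; the small multiple of `g` takes care of the curves along which
`g` is not integrable. -/
lemma IsUpperGradientOn.min_const {g h : X → ℝ≥0∞} {u : X → ℝ} {U : Set X} {M : ℝ} {ε : ℝ≥0∞}
    (hg : IsUpperGradientOn g u U) (hh : Measurable h) (hgh : ∀ x, u x < M → g x ≤ h x)
    (hε : ε ≠ 0) (hε' : ε ≠ ∞) :
    IsUpperGradientOn (fun x => h x + ε * g x) (fun x => min (u x) M) U := by
  refine ⟨hh.add (hg.1.const_mul ε), fun ℓ γ hℓ hγ hU => ?_⟩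
  by_cases hfin : ∫⁻ τ in Icc 0 ℓ, g (γ τ) = ∞
  · refine le_top.trans ?_
    calc ∞ = ∫⁻ τ in Icc 0 ℓ, ε * g (γ τ) := by
          rw [lintegral_const_mul' _ _ hε', hfin, ENNReal.mul_top hε]
      _ ≤ _ := lintegral_mono fun τ => le_add_self
  · exact (hg.isControlledOn hγ le_rfl le_rfl hU).min_const hℓ hfin
      fun τ _ hτ => (hgh _ hτ).trans le_self_add

lemma IsUpperGradientOn.neg {g : X → ℝ≥0∞} {u : X → ℝ} {U : Set X}
    (hg : IsUpperGradientOn g u U) : IsUpperGradientOn g (fun x => -u x) U := by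
  refine ⟨hg.1, fun ℓ γ hℓ hγ hU => ?_⟩
  have : -u (γ 0) - -u (γ ℓ) = -(u (γ 0) - u (γ ℓ)) := by ring
  rw [this, abs_neg]
  exact hg.2 ℓ γ hℓ hγ hU

lemma IsUpperGradientOn.sub_const {g : X → ℝ≥0∞} {u : X → ℝ} {U : Set X}
    (hg : IsUpperGradientOn g u U) (c : ℝ) : IsUpperGradientOn g (fun x => u x - c) U := by
  refine ⟨hg.1, fun ℓ γ hℓ hγ hU => ?_⟩
  have : u (γ 0) - c - (u (γ ℓ) - c) = u (γ 0) - u (γ ℓ) := by ring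
  rw [this]
  exact hg.2 ℓ γ hℓ hγ hU

lemma max_sub_zero_eq (a M : ℝ) : max (a - M) 0 = -min (-a) (-M) - M := by
  rcases le_total a M with h | h
  · rw [max_eq_right (by linarith), min_eq_right (by linarith)]; ring
  · rw [max_eq_left (by linarith), min_eq_left (by linarith)]; ring

lemma IsUpperGradientOn.max_sub {g h : X → ℝ≥0∞} {u : X → ℝ} {U : Set X} {M : ℝ} {ε : ℝ≥0∞}
    (hg : IsUpperGradientOn g u U) (hh : Measurable h) (hgh : ∀ x, M < u x → g x ≤ h x)
    (hε : ε ≠ 0) (hε' : ε ≠ ∞) :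
    IsUpperGradientOn (fun x => h x + ε * g x) (fun x => max (u x - M) 0) U := by
  simp_rw [max_sub_zero_eq]
  exact ((hg.neg.min_const hh (M := -M) (fun x hx => hgh x (neg_lt_neg_iff.1 hx)) hε hε').neg).sub_const M

/-- The cutoff `(1 - dist(·, K) / δ)₊`. -/
noncomputable def distCutoff {X : Type*} [MetricSpace X] (δ : ℝ) (K : Set X) (x : X) : ℝ :=
  max (1 - δ⁻¹ * Metric.infDist x K) 0

section distCutoff

variable {Y : Type*} [MetricSpace Y] {δ : ℝ} {K : Set Y} {x : Y}

lemma continuous_distCutoff : Continuous (distCutoff δ K) :=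
  (continuous_const.sub (continuous_const.mul (Metric.continuous_infDist_pt K))).max
    continuous_const

lemma abs_distCutoff_le_one (hδ : 0 < δ) (x : Y) : |distCutoff δ K x| ≤ 1 := by
  rw [distCutoff, abs_of_nonneg (le_max_right _ _)]
  refine max_le ?_ zero_le_one
  have : 0 ≤ δ⁻¹ * Metric.infDist x K := mul_nonneg (by positivity) Metric.infDist_nonneg
  linarith

lemma distCutoff_eq_one (hx : x ∈ K) : distCutoff δ K x = 1 := by
  simp [distCutoff, Metric.infDist_zero_of_mem hx]

lemma distCutoff_eq_zero (hne : K.Nonempty) (hδ : 0 < δ) (hx : x ∉ Metric.thickening δ K) :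
    distCutoff δ K x = 0 := by
  rw [Metric.mem_thickening_iff_infDist_lt hne, not_lt] at hx
  refine max_eq_right ?_
  have : δ⁻¹ * δ ≤ δ⁻¹ * Metric.infDist x K := by gcongr
  rw [inv_mul_cancel₀ hδ.ne'] at this
  linarith

lemma abs_distCutoff_sub_le (hδ : 0 < δ) (x y : Y) :
    |distCutoff δ K x - distCutoff δ K y| ≤ δ⁻¹ * dist x y := by
  refine (abs_max_sub_max_le_abs _ _ _).trans ?_
  rw [sub_sub_sub_cancel_left, ← mul_sub, abs_mul, abs_of_pos (inv_pos.2 hδ), abs_sub_comm]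
  gcongr
  have h1 := Metric.infDist_le_infDist_add_dist (s := K) (x := x) (y := y)
  have h2 := Metric.infDist_le_infDist_add_dist (s := K) (x := y) (y := x)
  rw [dist_comm] at h2
  exact abs_sub_le_iff.2 ⟨by linarith, by linarith⟩

end distCutoff

/-- An upper gradient of the product with a cutoff; the derivative of the cutoff does not contribute
on `K`. -/
lemma IsUpperGradientOn.cutoff {g A : X → ℝ≥0∞} {u : X → ℝ} {U K : Set X} {δ : ℝ}
    [OpensMeasurableSpace X]
    (hg : IsUpperGradientOn g u U) (hA : Measurable A)
    (hK : IsClosed K) (hne : K.Nonempty) (hδ : 0 < δ)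
    (hKU : Metric.cthickening δ K ⊆ U)
    (huA : ∀ x ∈ Metric.thickening δ K, ENNReal.ofReal |u x| ≤ A x) :
    IsUpperGradientOn (fun x => 2 * (Metric.cthickening δ K).indicator g x +
        ENNReal.ofReal δ⁻¹ * (Metric.thickening δ K \ K).indicator A x)
      (fun x => distCutoff δ K x * u x) univ := by
  refine ⟨?_, fun ℓ γ hℓ hγ _ => ?_⟩
  · exact ((hg.1.indicator Metric.isClosed_cthickening.measurableSet).const_mul _).add
      ((hA.indicator (Metric.isOpen_thickening.measurableSet.diff hK.measurableSet)).const_mul _)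
  set η : X → ℝ := distCutoff δ K with hη
  set G : X → ℝ≥0∞ := fun x => 2 * (Metric.cthickening δ K).indicator g x +
    ENNReal.ofReal δ⁻¹ * (Metric.thickening δ K \ K).indicator A x with hG
  have hγc := continuousOn_of_hasUnitSpeedOn hγ
  have hηc : Continuous η := continuous_distCutoff
  have hηK : ∀ x ∈ K, η x = 1 := fun x hx => distCutoff_eq_one hx
  have hη0 : ∀ x, η x ≠ 0 → x ∈ Metric.thickening δ K := fun x hx => by
    by_contra hn
    exact hx (distCutoff_eq_zero hne hδ hn)
  -- First gluing, along the zeros of the cutoff: on a gap the curve runs in the thickening, so its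
  -- closed arc lies in `cthickening δ K ⊆ U`, where `g` controls `u`.
  refine ofReal_abs_sub_le_of_isClosed (w := fun τ => η (γ τ) * u (γ τ)) (G := fun τ => G (γ τ))
    (F := {τ | η (γ τ) = 0}) hℓ ?_ ?_ ?_
  · rw [inter_comm]
    exact (hηc.comp_continuousOn hγc).preimage_isClosed_of_isClosed isClosed_Icc
      isClosed_singleton
  · rintro s ⟨hs, -⟩ t ⟨ht, -⟩ _
    simp only [mem_ofPred_eq] at hs ht
    simp [hs, ht]
  intro s t hs hst ht hF
  rcases hst.eq_or_lt with rfl | hlt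
  · simp
  have hsub : Icc s t ⊆ Icc 0 ℓ := Icc_subset_Icc hs ht
  have hIoo : MapsTo γ (Ioo s t) (Metric.thickening δ K) := fun τ hτ => hη0 _ (hF τ hτ)
  have hIcc : MapsTo γ (Icc s t) (Metric.cthickening δ K) := by
    have := (hIoo.mono_right (Metric.thickening_subset_cthickening δ K)).closure_of_continuousOn
      ((hγc.mono hsub).mono (closure_Ioo hlt.ne).subset)
    rwa [closure_Ioo hlt.ne, Metric.isClosed_cthickening.closure_eq] at this
  have hctl := hg.isControlledOn hγ hs ht (hIcc.mono_right hKU)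
  -- Second gluing, along the times in `K`: there the cutoff is `1` and only `u` varies, while on a
  -- gap the curve avoids `K` and the product rule applies with the slope term carried by the
  -- complement of `K`.
  refine ofReal_abs_sub_le_of_isClosed (w := fun τ => η (γ τ) * u (γ τ)) (G := fun τ => G (γ τ))
    (F := γ ⁻¹' K) hst ?_ ?_ ?_
  · rw [inter_comm]
    exact (hγc.mono hsub).preimage_isClosed_of_isClosed isClosed_Icc hK
  · rintro p ⟨hp, hp'⟩ q ⟨hq, hq'⟩ hpq
    simp only [hηK _ hp, hηK _ hq, one_mul]
    refine (hctl p q hp'.1 hpq hq'.2).trans (setLIntegral_Icc_mono fun τ hτ => ?_)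
    simp only [hG]
    rw [indicator_of_mem (hIcc ⟨hp'.1.trans hτ.1.le, hτ.2.le.trans hq'.2⟩), two_mul, add_assoc]
    exact le_self_add
  · intro p q hp hpq hq hKτ
    refine ((hctl.mono hp hq).mul_lipschitz (h := fun τ => η (γ τ)) (A := fun τ => A (γ τ))
      hpq hδ (fun τ => abs_distCutoff_le_one hδ _) ?_ ?_).trans (setLIntegral_Icc_mono fun τ hτ => ?_)
    · intro a b ha hab hb
      refine (abs_distCutoff_sub_le hδ _ _).trans ?_
      gcongr
      exact dist_le_of_hasUnitSpeedOn hγ (hsub ⟨hp.trans ha, by linarith⟩)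
        (hsub ⟨by linarith, hb.trans hq⟩) hab
    · exact fun τ hτ => huA _ (hIoo ⟨hp.trans_lt hτ.1, hτ.2.trans_le hq⟩)
    · have hτ' : τ ∈ Ioo s t := ⟨hp.trans_lt hτ.1, hτ.2.trans_le hq⟩
      simp only [hG]
      rw [indicator_of_mem (hIcc (Ioo_subset_Icc_self hτ')),
        indicator_of_mem (show γ τ ∈ Metric.thickening δ K \ K from ⟨hIoo hτ', hKτ τ hτ⟩)]

end LeastGradient

namespace LeastGradient

variable {X : Type*} [MetricSpace X] [MeasurableSpace X] {μ : Measure X}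

/-! ### Consequences of doubling -/

lemma IsDoubling.measure_ball_pos (h : IsDoubling μ) (x : X) {r : ℝ} (hr : 0 < r) :
    0 < μ (Metric.ball x r) := by
  obtain ⟨c, -, H⟩ := h
  simpa [mul_div_cancel₀] using (H x (r / 2) (by positivity)).1

lemma IsDoubling.measure_ball_lt_top (h : IsDoubling μ) (x : X) (r : ℝ) :
    μ (Metric.ball x r) < ∞ := by
  obtain ⟨c, -, H⟩ := h
  rcases le_or_gt r 0 with hr | hr
  · simp [Metric.ball_eq_empty.2 hr]
  · exact (H x r hr).2.2

lemma IsDoubling.measure_lt_top_of_isBounded (h : IsDoubling μ) {s : Set X}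
    (hs : Bornology.IsBounded s) : μ s < ∞ := by
  rcases s.eq_empty_or_nonempty with rfl | ⟨x, -⟩
  · simp
  obtain ⟨r, hr⟩ := hs.subset_ball x
  exact (measure_mono hr).trans_lt (h.measure_ball_lt_top x r)

/-- A complete space with a doubling measure is proper. -/
lemma IsDoubling.properSpace [CompleteSpace X] [OpensMeasurableSpace X] (h : IsDoubling μ) :
    ProperSpace X := by
  obtain ⟨c, hc, H⟩ := id h
  refine ProperSpace.of_isCompact_closedBall_of_le 1 fun x R hR =>
    isCompact_iff_totallyBounded_isComplete.2 ⟨?_, Metric.isClosed_closedBall.isComplete⟩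
  have hpow : ∀ (y : X) (r : ℝ), 0 < r → ∀ k : ℕ,
      μ (Metric.ball y (2 ^ k * r)) ≤ (c : ℝ≥0∞) ^ k * μ (Metric.ball y r) := by
    intro y r hr k
    induction k with
    | zero => simp
    | succ k ih =>
      calc μ (Metric.ball y (2 ^ (k + 1) * r)) = μ (Metric.ball y (2 * (2 ^ k * r))) := by
            rw [pow_succ']; ring_nf
        _ ≤ c * μ (Metric.ball y (2 ^ k * r)) := (H y _ (by positivity)).2.1
        _ ≤ c * ((c : ℝ≥0∞) ^ k * μ (Metric.ball y r)) := by gcongr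
        _ = _ := by rw [pow_succ']; ring
  rw [Metric.totallyBounded_iff]
  intro ε hε
  -- A maximal `ε/2`-separated set `N`. It is an `ε`-net by maximality, and finite because the
  -- disjoint balls of radius `ε/4` have measure at least `m > 0` by iterated doubling and lie in
  -- one ball of finite measure.
  obtain ⟨N, hN⟩ := zorn_subset
    {N : Set X | N ⊆ Metric.closedBall x R ∧ N.Pairwise fun y z => ε / 2 < dist y z} (by
      intro C hC hchain
      refine ⟨⋃₀ C, ⟨sUnion_subset fun s hs => (hC hs).1, ?_⟩, fun s hs => subset_sUnion_of_mem hs⟩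
      exact (pairwise_sUnion hchain.directedOn).2 fun s hs => (hC hs).2)
  refine ⟨N, ?_, fun y hy => ?_⟩
  · obtain ⟨k, hk⟩ := pow_unbounded_of_one_lt ((2 * R + 1) / (ε / 4)) (one_lt_two)
    rw [div_lt_iff₀ (by positivity)] at hk
    set m := μ (Metric.ball x 1) / (c : ℝ≥0∞) ^ k with hm
    have hck : (c : ℝ≥0∞) ^ k ≠ 0 := pow_ne_zero _ (by simpa using hc.ne')
    have hck' : (c : ℝ≥0∞) ^ k ≠ ∞ := ENNReal.pow_ne_top ENNReal.coe_ne_top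
    have hm0 : 0 < m := ENNReal.div_pos (h.measure_ball_pos x one_pos).ne' hck'
    have hfin : {i : N | m ≤ μ (Metric.ball (i : X) (ε / 4))}.Finite := by
      refine Measure.finite_const_le_meas_of_disjoint_iUnion μ hm0
        (fun i => Metric.isOpen_ball.measurableSet) ?_ ?_
      · intro i j hij
        refine Metric.ball_disjoint_ball ?_
        have := hN.1.2 i.2 j.2 (fun e => hij (Subtype.ext e))
        linarith
      · refine ((measure_mono (iUnion_subset fun i => ?_)).trans_lt
          (h.measure_ball_lt_top x (R + ε))).ne
        have := hN.1.1 i.2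
        rw [Metric.mem_closedBall] at this
        exact Metric.ball_subset_ball' (by linarith)
    have huniv : {i : N | m ≤ μ (Metric.ball (i : X) (ε / 4))} = univ := by
      refine eq_univ_of_forall fun i => ?_
      rw [mem_ofPred_eq, hm, ENNReal.div_le_iff' hck hck']
      refine (measure_mono ?_).trans (hpow i (ε / 4) (by positivity) k)
      have := hN.1.1 i.2
      rw [Metric.mem_closedBall, dist_comm] at this
      exact Metric.ball_subset_ball' (by linarith)
    rw [huniv] at hfin
    have : Finite N := finite_univ_iff.1 hfin
    exact N.toFinite
  · simp only [mem_iUnion, exists_prop]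
    by_contra! hcon
    have hyN : y ∈ N := by
      refine hN.2 (y := insert y N) ⟨insert_subset hy hN.1.1, ?_⟩ (subset_insert y N)
        (mem_insert y N)
      refine hN.1.2.insert fun z hz hne => ?_
      have h1 : ε ≤ dist y z := by simpa using hcon z hz
      exact ⟨by linarith, by rw [dist_comm]; linarith⟩
    exact hcon y hyN (Metric.mem_ball_self hε)

/-- Countably many balls with closure compactly inside `U` cover `U`. -/
lemma aemeasurable_restrict_of_compactlyContained [ProperSpace X] {u : X → ℝ} {U : Set X}
    (hU : IsOpen U) (h : ∀ V, CompactlyContained V U → AEMeasurable u (μ.restrict V)) :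
    AEMeasurable u (μ.restrict U) := by
  have hr : ∀ x ∈ U, ∃ r > 0, Metric.closedBall x r ⊆ U := fun x hx =>
    Metric.nhds_basis_closedBall.mem_iff.1 (hU.mem_nhds hx)
  choose! r hr0 hrU using hr
  obtain ⟨t, htU, htc, hcov⟩ := TopologicalSpace.countable_cover_nhdsWithin
    (f := fun x => Metric.ball x (r x)) (s := U)
    fun x hx => mem_nhdsWithin_of_mem_nhds (Metric.ball_mem_nhds x (hr0 x hx))
  have := htc.to_subtype
  rw [biUnion_eq_iUnion] at hcov
  refine AEMeasurable.mono_set hcov (AEMeasurable.iUnion fun x => h _ ?_)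
  exact ⟨Metric.isOpen_ball, (isCompact_closedBall _ _).of_isClosed_subset isClosed_closure
    Metric.closure_ball_subset_closedBall,
    Metric.closure_ball_subset_closedBall.trans (hrU x (htU x.2))⟩

lemma MemNewtonianLoc.aemeasurable [ProperSpace X] {u : X → ℝ} {U : Set X} (hU : IsOpen U)
    (h : MemNewtonianLoc μ u U) : AEMeasurable u (μ.restrict U) :=
  aemeasurable_restrict_of_compactlyContained hU fun V hV => (h V hV).1.aemeasurable

/-! ### Truncations and the total variation -/

/-- Upper gradients are tested on every curve, so the level sets must be covered at every point,
although `v` is only a.e. measurable. One measurable null set is added to both sides. -/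
lemma exists_measurableSet_lt_gt {X : Type*} [MeasurableSpace X] {ν : Measure X} {v : X → ℝ} (hv : AEMeasurable v ν) (M : ℝ) :
    ∃ A B : Set X, MeasurableSet A ∧ MeasurableSet B ∧ (∀ x, v x < M → x ∈ A) ∧
      (∀ x, M < v x → x ∈ B) ∧ ν (A ∩ B) = 0 := by
  set N := toMeasurable ν {x | ¬ v x = hv.mk v x} with hN
  have hN0 : ν N = 0 := by rw [hN, measure_toMeasurable]; exact hv.ae_eq_mk
  have hNm : MeasurableSet N := measurableSet_toMeasurable _ _
  have hmem : ∀ x, x ∉ N → v x = hv.mk v x := fun x hx => by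
    by_contra hne
    exact hx (subset_toMeasurable ν _ hne)
  refine ⟨hv.mk v ⁻¹' Iio M ∪ N, hv.mk v ⁻¹' Ioi M ∪ N,
    (hv.measurable_mk measurableSet_Iio).union hNm,
    (hv.measurable_mk measurableSet_Ioi).union hNm, fun x hx => ?_, fun x hx => ?_, ?_⟩
  · by_cases hxN : x ∈ N
    · exact Or.inr hxN
    · exact Or.inl (by rw [hmem x hxN] at hx; exact hx)
  · by_cases hxN : x ∈ N
    · exact Or.inr hxN
    · exact Or.inl (by rw [hmem x hxN] at hx; exact hx)
  · refine measure_mono_null ?_ hN0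
    rintro x ⟨h1 | h1, h2 | h2⟩
    · exact absurd (show hv.mk v x < M from h1) (not_lt.2 (le_of_lt h2))
    all_goals assumption

lemma liminf_add_liminf_le (a b : ℕ → ℝ≥0∞) :
    liminf a atTop + liminf b atTop ≤ liminf (a + b) atTop := by
  have hmono : ∀ c : ℕ → ℝ≥0∞, Monotone fun n => ⨅ i ≥ n, c i :=
    fun c m n hmn => biInf_mono fun i hi => hmn.trans hi
  simp only [liminf_eq_iSup_iInf_of_nat]
  rw [ENNReal.iSup_add_iSup_of_monotone (hmono a) (hmono b)]
  exact iSup_mono fun n => le_iInf₂ fun i hi => add_le_add (iInf₂_le i hi) (iInf₂_le i hi)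

lemma variationOpen_le {u : X → ℝ} {U : Set X} {v : ℕ → X → ℝ} {g : ℕ → X → ℝ≥0∞}
    (h : ∀ i, MemNewtonianLoc μ (v i) U ∧ IsUpperGradientOn (g i) (v i) U)
    (hv : TendstoL1Loc μ v u U) :
    variationOpen μ u U ≤ liminf (fun i => ∫⁻ x in U, g i x ∂μ) atTop :=
  iInf_le_of_le v (iInf_le_of_le g (iInf_le_of_le h (iInf_le _ hv)))

lemma TendstoL1Loc.comp_lipschitz {v : ℕ → X → ℝ} {u : X → ℝ} {U : Set X} {φ : ℝ → ℝ}
    (hφ : ∀ a b, |φ a - φ b| ≤ |a - b|) (h : TendstoL1Loc μ v u U) :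
    TendstoL1Loc μ (fun i x => φ (v i x)) (fun x => φ (u x)) U := fun V hV =>
  tendsto_of_tendsto_of_tendsto_of_le_of_le tendsto_const_nhds (h V hV) (fun _ => zero_le)
    fun _ => lintegral_mono fun _ => ENNReal.ofReal_le_ofReal (hφ _ _)

lemma MemNewtonian.min_const {u : X → ℝ} {V : Set X} (h : MemNewtonian μ u V) (hV : μ V < ∞)
    (M : ℝ) : MemNewtonian μ (fun x => min (u x) M) V := by
  obtain ⟨hu, g, hg, hgi⟩ := h
  have : IsFiniteMeasure (μ.restrict V) := ⟨by simpa using hV⟩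
  refine ⟨Integrable.inf hu (integrable_const M), fun x => g x + 1 * g x,
    hg.min_const hg.1 (fun _ _ => le_rfl) one_ne_zero ENNReal.one_ne_top, ?_⟩
  simp only [one_mul]
  rw [lintegral_add_left hg.1]
  exact ENNReal.add_lt_top.2 ⟨hgi, hgi⟩

lemma MemNewtonian.max_sub {u : X → ℝ} {V : Set X} (h : MemNewtonian μ u V) (hV : μ V < ∞)
    (M : ℝ) : MemNewtonian μ (fun x => max (u x - M) 0) V := by
  obtain ⟨hu, g, hg, hgi⟩ := h
  have : IsFiniteMeasure (μ.restrict V) := ⟨by simpa using hV⟩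
  refine ⟨Integrable.pos_part (Integrable.sub hu (integrable_const M)), fun x => g x + 1 * g x,
    hg.max_sub hg.1 (fun _ _ => le_rfl) one_ne_zero ENNReal.one_ne_top, ?_⟩
  simp only [one_mul]
  rw [lintegral_add_left hg.1]
  exact ENNReal.add_lt_top.2 ⟨hgi, hgi⟩

/-- Truncate an approximating sequence: the density `g i` is kept on `A i` for the minimum and on `B
i` for the positive part, and these sets overlap in a null set. The extra `ε * g i` in each
truncated gradient accounts for `1 + 2ε`. -/
lemma variationOpen_min_add_max_le [CompleteSpace X] [OpensMeasurableSpace X] (hμ : IsDoubling μ)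
    (u : X → ℝ) {U : Set X} (hU : IsOpen U) (M : ℝ) :
    variationOpen μ (fun x => min (u x) M) U + variationOpen μ (fun x => max (u x - M) 0) U ≤
      variationOpen μ u U := by
  have := hμ.properSpace
  refine le_iInf fun v => le_iInf fun g => le_iInf fun h => le_iInf fun hv => ?_
  have hVfin : ∀ V, CompactlyContained V U → μ V < ∞ := fun V hV =>
    (measure_mono subset_closure).trans_lt (hμ.measure_lt_top_of_isBounded hV.2.1.isBounded)
  set L := liminf (fun i => ∫⁻ x in U, g i x ∂μ) atTop with hL
  choose A B hA hB hvA hvB hAB using fun i =>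
    exists_measurableSet_lt_gt ((h i).1.aemeasurable hU) M
  have key : ∀ ε : ℝ≥0, 0 < ε → variationOpen μ (fun x => min (u x) M) U +
      variationOpen μ (fun x => max (u x - M) 0) U ≤ (1 + 2 * ε) * L := by
    intro ε hε
    have hε0 : (ε : ℝ≥0∞) ≠ 0 := by simpa using hε.ne'
    calc _ ≤ liminf (fun i => ∫⁻ x in U, ((A i).indicator (g i) x + ε * g i x) ∂μ) atTop +
          liminf (fun i => ∫⁻ x in U, ((B i).indicator (g i) x + ε * g i x) ∂μ) atTop := by
          refine add_le_add (variationOpen_le (v := fun i x => min (v i x) M) (fun _ => ⟨?_, ?_⟩)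
            (hv.comp_lipschitz (φ := fun a => min a M) fun a b => ?_))
            (variationOpen_le (v := fun i x => max (v i x - M) 0) (fun _ => ⟨?_, ?_⟩)
            (hv.comp_lipschitz (φ := fun a => max (a - M) 0) fun a b => ?_))
          · exact fun V hV => ((h _).1 V hV).min_const (hVfin V hV) M
          · exact (h _).2.min_const ((h _).2.1.indicator (hA _))
              (fun x hx => by rw [indicator_of_mem (hvA _ x hx)]) hε0 ENNReal.coe_ne_top
          · exact (abs_min_sub_min_le_max _ _ _ _).trans (by simp)
          · exact fun V hV => ((h _).1 V hV).max_sub (hVfin V hV) M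
          · exact (h _).2.max_sub ((h _).2.1.indicator (hB _))
              (fun x hx => by rw [indicator_of_mem (hvB _ x hx)]) hε0 ENNReal.coe_ne_top
          · exact (abs_max_sub_max_le_abs _ _ _).trans (by simp)
      _ ≤ liminf ((fun i => ∫⁻ x in U, ((A i).indicator (g i) x + ε * g i x) ∂μ) +
          fun i => ∫⁻ x in U, ((B i).indicator (g i) x + ε * g i x) ∂μ) atTop :=
          liminf_add_liminf_le _ _
      _ ≤ liminf (fun i => (1 + 2 * ε) * ∫⁻ x in U, g i x ∂μ) atTop := by
          refine liminf_le_liminf (Eventually.of_forall fun i => ?_)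
          have hgm := (h i).2.1
          simp only [Pi.add_apply]
          have hm : Measurable fun x => (A i).indicator (g i) x + ε * g i x :=
            (hgm.indicator (hA i)).add (hgm.const_mul _)
          rw [← lintegral_add_left hm,
            ← lintegral_const_mul _ hgm]
          have hnull : ∀ᵐ x ∂μ.restrict U, x ∉ A i ∩ B i := measure_eq_zero_iff_ae_notMem.1 (hAB i)
          refine lintegral_mono_ae (hnull.mono fun x hx => ?_)
          have : (A i).indicator (g i) x + (B i).indicator (g i) x ≤ g i x := by
            by_cases hxA : x ∈ A i <;> by_cases hxB : x ∈ B i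
            · exact absurd ⟨hxA, hxB⟩ hx
            all_goals simp [hxA, hxB]
          calc _ = ((A i).indicator (g i) x + (B i).indicator (g i) x) + 2 * ε * g i x := by ring
            _ ≤ g i x + 2 * ε * g i x := by gcongr
            _ = _ := by ring
      _ = (1 + 2 * ε) * L := by
          rw [ENNReal.liminf_const_mul_of_ne_top (by finiteness)]
  by_cases hLtop : L = ∞
  · simp [hLtop]
  refine ENNReal.le_of_forall_pos_le_add fun η hη _ => ?_
  obtain ⟨ε, hε, hlt⟩ := ENNReal.exists_nnreal_pos_mul_lt (a := 2 * L) (b := η)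
    (by finiteness) (by simpa using hη.ne')
  calc _ ≤ (1 + 2 * ε) * L := key ε hε
    _ = L + ε * (2 * L) := by ring
    _ ≤ L + η := by gcongr

lemma variation_le_variationOpen {u : X → ℝ} {A U : Set X} (hU : IsOpen U) (hAU : A ⊆ U) :
    variation μ u A ≤ variationOpen μ u U :=
  iInf_le_of_le U (iInf_le_of_le hU (iInf_le _ hAU))

lemma variation_min_add_max_le [CompleteSpace X] [OpensMeasurableSpace X] (hμ : IsDoubling μ)
    (u : X → ℝ) (A : Set X) (M : ℝ) :
    variation μ (fun x => min (u x) M) A + variation μ (fun x => max (u x - M) 0) A ≤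
      variation μ u A :=
  le_iInf fun _ => le_iInf fun hU => le_iInf fun hAU =>
    (add_le_add (variation_le_variationOpen hU hAU) (variation_le_variationOpen hU hAU)).trans
      (variationOpen_min_add_max_le hμ u hU M)

lemma variation_mono {u : X → ℝ} {A B : Set X} (h : A ⊆ B) : variation μ u A ≤ variation μ u B :=
  le_iInf fun _ => le_iInf fun hU => le_iInf fun hBU => variation_le_variationOpen hU (h.trans hBU)

lemma MemNewtonian.neg {u : X → ℝ} {V : Set X} (h : MemNewtonian μ u V) :
    MemNewtonian μ (fun x => -u x) V :=
  ⟨Integrable.neg h.1, h.2.imp fun _ hg => ⟨hg.1.neg, hg.2⟩⟩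

lemma variation_neg_le (u : X → ℝ) (A : Set X) :
    variation μ (fun x => -u x) A ≤ variation μ u A := by
  refine le_iInf fun U => le_iInf fun hU => le_iInf fun hAU =>
    (variation_le_variationOpen hU hAU).trans ?_
  refine le_iInf fun v => le_iInf fun g => le_iInf fun h => le_iInf fun hv => ?_
  refine variationOpen_le (v := fun i x => -v i x)
    (fun i => ⟨fun V hV => ((h i).1 V hV).neg, (h i).2.neg⟩)
    (hv.comp_lipschitz (φ := fun a => -a) fun a b => ?_)
  rw [neg_sub_neg, abs_sub_comm]

end LeastGradient

namespace LeastGradient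

/-! ### Functions of vanishing variation -/

/-- The majorant must hold at every point in order to enter an upper gradient; it is set to `∞` on a
null set. -/
lemma exists_measurable_ge_ae_eq {X : Type*} [MeasurableSpace X] {ν : Measure X} {f : X → ℝ≥0∞}
    (hf : AEMeasurable f ν) : ∃ A : X → ℝ≥0∞, Measurable A ∧ f ≤ A ∧ A =ᵐ[ν] f := by
  classical
  set N := toMeasurable ν {x | ¬ f x = hf.mk f x} with hN
  have hN0 : ν N = 0 := by rw [hN, measure_toMeasurable]; exact hf.ae_eq_mk
  refine ⟨N.piecewise (fun _ => ∞) (hf.mk f),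
    Measurable.piecewise (measurableSet_toMeasurable _ _) measurable_const hf.measurable_mk,
    fun x => ?_, ?_⟩
  · by_cases hx : x ∈ N
    · simp [hx]
    · rw [piecewise_eq_of_notMem _ _ _ hx]
      by_contra hne
      exact hx (subset_toMeasurable ν _ fun h => hne h.le)
  · filter_upwards [measure_eq_zero_iff_ae_notMem.1 hN0, hf.ae_eq_mk] with x hx h
    rw [piecewise_eq_of_notMem _ _ _ hx, h]

variable {X : Type*} [MetricSpace X] [MeasurableSpace X] {μ : Measure X}

/-- If `w` vanishes outside `Ω` and has zero variation in the closure of `Ω`, it is arbitrarily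
close to constants on every ball. -/
lemma exists_lintegral_sub_const_le [CompleteSpace X] [BorelSpace X] (hμ : IsDoubling μ)
    (hP : SupportsPoincare μ) {w : X → ℝ} {Ω : Set X} {x₀ : X} (hx₀ : x₀ ∈ Ω)
    (hw : ∀ᵐ x ∂μ, x ∉ Ω → w x = 0) (hvar : variation μ w (closure Ω) = 0) {R : ℝ} (hR : 0 < R) :
    ∃ C : ℝ≥0∞, C ≠ ∞ ∧ ∀ ε : ℝ≥0∞, 0 < ε →
      ∃ c : ℝ, ∫⁻ x in Metric.ball x₀ R, ENNReal.ofReal |w x - c| ∂μ ≤ C * ε := by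
  have := hμ.properSpace
  obtain ⟨cP, lam, hcP, hlam, hP⟩ := hP
  have hlamR : R ≤ lam * R := le_mul_of_one_le_left hR.le hlam
  set B := Metric.ball x₀ R with hB
  set B' := Metric.ball x₀ (lam * R) with hB'
  have hBB' : B ⊆ B' := Metric.ball_subset_ball hlamR
  have hμB0 : μ B ≠ 0 := (hμ.measure_ball_pos _ hR).ne'
  have hμB : μ B ≠ ∞ := (hμ.measure_ball_lt_top _ _).ne
  have hμB'0 : μ B' ≠ 0 := (hμ.measure_ball_pos _ (by positivity)).ne'
  -- The `1` bounds the distance from `w` to the cut-off approximant on `B`, the rest is the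
  -- Poincaré inequality; `3` is `2` from the product rule plus `1` from the slope of the cutoff.
  refine ⟨1 + μ B * (ENNReal.ofReal (cP * R) * (3 / μ B')), ?_, fun ε hε => ?_⟩
  · have : 3 / μ B' ≠ ∞ := ENNReal.div_ne_top (by norm_num) hμB'0
    finiteness
  -- Truncation to a closed ball makes `K` compact, so that a whole `δ`-neighbourhood of it fits in
  -- `U`.
  set K := closure Ω ∩ Metric.closedBall x₀ (lam * R) with hKdef
  have hKcl : IsClosed K := isClosed_closure.inter Metric.isClosed_closedBall
  have hK : IsCompact K := (isCompact_closedBall _ _).of_isClosed_subset hKcl inter_subset_right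
  have hKne : K.Nonempty := ⟨x₀, subset_closure hx₀, Metric.mem_closedBall_self (by positivity)⟩
  have hlt : variation μ w (closure Ω) < ε := hvar ▸ hε
  simp only [variation, iInf_lt_iff] at hlt
  obtain ⟨U, hU, hΩU, hlt⟩ := hlt
  simp only [variationOpen, iInf_lt_iff] at hlt
  obtain ⟨v, g, h, hv, hlt⟩ := hlt
  obtain ⟨δ, hδ, hδU⟩ := hK.exists_cthickening_subset_open hU (inter_subset_left.trans hΩU)
  set V := Metric.thickening δ K with hVdef
  have hV : CompactlyContained V U :=
    ⟨Metric.isOpen_thickening, hK.cthickening.of_isClosed_subset isClosed_closure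
      (Metric.closure_thickening_subset_cthickening δ K),
      (Metric.closure_thickening_subset_cthickening δ K).trans hδU⟩
  have hVm : MeasurableSet V := hV.1.measurableSet
  -- As `δ` is fixed before the index `i`, the `L^1` error can be made at most `δ ε`, which absorbs
  -- the slope `δ⁻¹`.
  have hδε : 0 < min ε (ENNReal.ofReal δ * ε) :=
    lt_min hε (ENNReal.mul_pos (ENNReal.ofReal_pos.2 hδ).ne' hε.ne')
  obtain ⟨i, hgi, hvi⟩ :=
    ((frequently_lt_of_liminf_lt (by isBoundedDefault) hlt).and_eventually
      ((hv V hV).eventually_lt_const hδε)).exists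
  obtain ⟨hN, hg⟩ := h i
  have hvV : IntegrableOn (v i) V μ := (hN V hV).1
  obtain ⟨A, hAm, hvA, hAv⟩ := exists_measurable_ge_ae_eq
    (f := fun x => ENNReal.ofReal |v i x|) (ν := μ.restrict V)
    (ENNReal.measurable_ofReal.comp_aemeasurable
      (continuous_abs.measurable.comp_aemeasurable hvV.aemeasurable))
  have hAv' := (ae_restrict_iff' hVm).1 hAv
  set η : X → ℝ := distCutoff δ K with hη
  have hη1 : ∀ x, |η x| ≤ 1 := abs_distCutoff_le_one hδ
  have hηK : ∀ x ∈ K, η x = 1 := fun x hx => distCutoff_eq_one hx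
  have hη0 : ∀ x, x ∉ V → η x = 0 := fun x hx => distCutoff_eq_zero hKne hδ hx
  set z : X → ℝ := fun x => η x * v i x with hz
  have hzint : Integrable z μ := by
    rw [← integrableOn_iff_integrable_of_support_subset (s := V)]
    · exact Integrable.bdd_mul (c := 1) hvV continuous_distCutoff.measurable.aestronglyMeasurable
        (Eventually.of_forall fun x => hη1 x)
    · intro x hx
      by_contra hxV
      exact hx (by simp [hz, hη0 x hxV])
  have hug := hg.cutoff hAm hKcl hKne hδ hδU fun x _ => hvA x
  set G : X → ℝ≥0∞ := fun x => 2 * (Metric.cthickening δ K).indicator (g i) x +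
        ENNReal.ofReal δ⁻¹ * (V \ K).indicator A x with hG
  have hPz := hP x₀ R hR z G hzint.locallyIntegrable hug
  have hoff : ∀ᵐ x ∂μ, x ∈ B' → x ∉ K → w x = 0 := hw.mono fun x hx hxB hxK => hx fun hxΩ =>
    hxK ⟨subset_closure hxΩ, Metric.ball_subset_closedBall hxB⟩
  have hVle : ∀ s : Set X, ∫⁻ x in s, V.indicator (fun x => ENNReal.ofReal |v i x - w x|) x ∂μ ≤
      ∫⁻ x in V, ENNReal.ofReal |v i x - w x| ∂μ := fun s => by
    rw [← lintegral_indicator hVm]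
    exact setLIntegral_le_lintegral _ _
  have hGint : ∫⁻ x in B', G x ∂μ ≤ 3 * ε := by
    have h1 : ∫⁻ x in B', (Metric.cthickening δ K).indicator (g i) x ∂μ ≤ ε := by
      refine (setLIntegral_le_lintegral _ _).trans ?_
      rw [lintegral_indicator Metric.isClosed_cthickening.measurableSet]
      exact (lintegral_mono_set hδU).trans hgi.le
    have h2 : ∫⁻ x in B', (V \ K).indicator A x ∂μ ≤ ENNReal.ofReal δ * ε := by
      refine le_trans ?_ ((hVle B').trans (hvi.le.trans (min_le_right _ _)))
      refine lintegral_mono_ae ((ae_restrict_iff' Metric.isOpen_ball.measurableSet).2 ?_)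
      filter_upwards [hoff, hAv'] with x hx hxA hxB
      by_cases hxV : x ∈ V
      · by_cases hxK : x ∈ K
        · simp [hxK]
        · rw [indicator_of_mem hxV, indicator_of_mem (show x ∈ V \ K from ⟨hxV, hxK⟩), hxA hxV,
            hx hxB hxK, sub_zero]
      · simp [hxV]
    have hm1 : Measurable fun x => 2 * (Metric.cthickening δ K).indicator (g i) x :=
      (hg.1.indicator Metric.isClosed_cthickening.measurableSet).const_mul _
    simp only [hG]
    rw [lintegral_add_left hm1, lintegral_const_mul' 2 _ (by norm_num),
      lintegral_const_mul' (ENNReal.ofReal δ⁻¹) _ ENNReal.ofReal_ne_top]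
    calc _ ≤ 2 * ε + ENNReal.ofReal δ⁻¹ * (ENNReal.ofReal δ * ε) := by gcongr
      _ = 2 * ε + ENNReal.ofReal (δ⁻¹ * δ) * ε := by
          rw [← mul_assoc, ← ENNReal.ofReal_mul (by positivity)]
      _ = 3 * ε := by
          rw [inv_mul_cancel₀ hδ.ne', ENNReal.ofReal_one]
          ring
  have hwz : ∫⁻ x in B, ENNReal.ofReal |w x - z x| ∂μ ≤ ε := by
    refine le_trans ?_ ((hVle B).trans (hvi.le.trans (min_le_left _ _)))
    refine lintegral_mono_ae ((ae_restrict_iff' Metric.isOpen_ball.measurableSet).2 ?_)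
    filter_upwards [hoff] with x hx hxB
    by_cases hxK : x ∈ K
    · have hxV : x ∈ V := Metric.self_subset_thickening hδ _ hxK
      rw [indicator_of_mem hxV, hz]
      simp only [hηK x hxK, one_mul]
      rw [abs_sub_comm]
    · rw [hx (hBB' hxB) hxK]
      by_cases hxV : x ∈ V
      · rw [indicator_of_mem hxV, hx (hBB' hxB) hxK, zero_sub, abs_neg, sub_zero, hz, abs_mul]
        exact ENNReal.ofReal_le_ofReal (mul_le_of_le_one_left (abs_nonneg _) (hη1 x))
      · simp [hz, hη0 x hxV]
  set m := ⨍ y in B, z y ∂μ with hm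
  refine ⟨m, ?_⟩
  have hzm : ∫⁻ x in B, ENNReal.ofReal |z x - m| ∂μ ≤
      μ B * (ENNReal.ofReal (cP * R) * (3 / μ B')) * ε := by
    rw [setLAverage_eq, setLAverage_eq, ENNReal.div_le_iff' hμB0 hμB] at hPz
    refine hPz.trans ?_
    calc _ ≤ μ B * (ENNReal.ofReal (cP * R) * (3 * ε / μ B')) := by gcongr
      _ = _ := by simp only [div_eq_mul_inv]; ring
  calc ∫⁻ x in B, ENNReal.ofReal |w x - m| ∂μ
      ≤ ∫⁻ x in B, (ENNReal.ofReal |w x - z x| + ENNReal.ofReal |z x - m|) ∂μ :=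
        lintegral_mono fun x => ofReal_abs_sub_le_add le_rfl le_rfl
    _ = (∫⁻ x in B, ENNReal.ofReal |w x - z x| ∂μ) + ∫⁻ x in B, ENNReal.ofReal |z x - m| ∂μ := by
        refine lintegral_add_right' _ (ENNReal.measurable_ofReal.comp_aemeasurable
          (continuous_abs.measurable.comp_aemeasurable ?_))
        exact (hzint.aemeasurable.restrict).sub_const m
    _ ≤ ε + μ B * (ENNReal.ofReal (cP * R) * (3 / μ B')) * ε := add_le_add hwz hzm
    _ = _ := by ring

/-- On a ball `B` with `μ (B \ Ω) > 0`, a constant `c` close to `w` is close to `0`, since `w = 0`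
on `B \ Ω`; so `w = 0` on `B`. Such balls exhaust `X`. -/
lemma ae_eq_zero_of_variation_closure_eq_zero [CompleteSpace X] [BorelSpace X] (hμ : IsDoubling μ)
    (hP : SupportsPoincare μ) {w : X → ℝ} (hwm : AEMeasurable w μ) {Ω : Set X} (hΩ : IsOpen Ω)
    (hne : Ω.Nonempty) (hΩc : 0 < μ Ωᶜ) (hw : ∀ᵐ x ∂μ, x ∉ Ω → w x = 0)
    (hvar : variation μ w (closure Ω) = 0) : ∀ᵐ x ∂μ, w x = 0 := by
  obtain ⟨x₀, hx₀⟩ := hne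
  have hball : ∀ R : ℝ, 0 < R → 0 < μ (Metric.ball x₀ R \ Ω) →
      ∀ᵐ x ∂μ, x ∈ Metric.ball x₀ R → w x = 0 := by
    intro R hR hE
    obtain ⟨C, hC, H⟩ := exists_lintegral_sub_const_le hμ hP hx₀ hw hvar hR
    set B := Metric.ball x₀ R with hB
    have hBm : MeasurableSet B := Metric.isOpen_ball.measurableSet
    have hμB : μ B ≠ ∞ := (hμ.measure_ball_lt_top _ _).ne
    have hμE : μ (B \ Ω) ≠ ∞ := measure_ne_top_of_subset sdiff_subset hμB
    -- Multiplying by `μ (B \ Ω)` lets the bound on `|c| μ (B \ Ω)` be inserted without division.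
    have key : ∀ ε : ℝ≥0∞, 0 < ε → μ (B \ Ω) * ∫⁻ x in B, ENNReal.ofReal |w x| ∂μ ≤
        ε * ((μ (B \ Ω) + μ B) * C) := by
      intro ε hε
      obtain ⟨c, hc⟩ := H ε hε
      have h1 : ENNReal.ofReal |c| * μ (B \ Ω) ≤ C * ε := by
        refine le_trans ?_ hc
        rw [← setLIntegral_const]
        refine le_trans (lintegral_mono_ae ?_) (lintegral_mono_set (sdiff_subset (t := Ω)))
        refine (ae_restrict_iff' (hBm.diff hΩ.measurableSet)).2 ?_
        filter_upwards [hw] with x hx hxE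
        rw [hx hxE.2, zero_sub, abs_neg]
      have h2 : ∫⁻ x in B, ENNReal.ofReal |w x| ∂μ ≤ C * ε + ENNReal.ofReal |c| * μ B := by
        calc ∫⁻ x in B, ENNReal.ofReal |w x| ∂μ
            ≤ ∫⁻ x in B, (ENNReal.ofReal |w x - c| + ENNReal.ofReal |c|) ∂μ := by
              refine lintegral_mono fun x => ?_
              have := ofReal_abs_sub_le_add (x := w x) (y := c) (z := 0) le_rfl le_rfl
              simpa using this
          _ = (∫⁻ x in B, ENNReal.ofReal |w x - c| ∂μ) + ENNReal.ofReal |c| * μ B := by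
              rw [lintegral_add_right _ measurable_const, setLIntegral_const]
          _ ≤ _ := by gcongr
      calc _ ≤ μ (B \ Ω) * (C * ε + ENNReal.ofReal |c| * μ B) := by gcongr
        _ = μ (B \ Ω) * (C * ε) + ENNReal.ofReal |c| * μ (B \ Ω) * μ B := by ring
        _ ≤ μ (B \ Ω) * (C * ε) + C * ε * μ B := by gcongr
        _ = _ := by ring
    have hzero : μ (B \ Ω) * ∫⁻ x in B, ENNReal.ofReal |w x| ∂μ = 0 := by
      refine le_antisymm (le_of_forall_gt fun a ha => ?_) zero_le
      obtain ⟨ε, hε, hlt⟩ := ENNReal.exists_nnreal_pos_mul_lt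
        (a := (μ (B \ Ω) + μ B) * C) (b := a) (by finiteness) ha.ne'
      exact (key ε (by simpa using hε)).trans_lt hlt
    have hm : AEMeasurable (fun x => ENNReal.ofReal |w x|) (μ.restrict B) :=
      ENNReal.measurable_ofReal.comp_aemeasurable
        (continuous_abs.measurable.comp_aemeasurable hwm.restrict)
    rw [mul_eq_zero, or_iff_right hE.ne', lintegral_eq_zero_iff' hm] at hzero
    filter_upwards [(ae_restrict_iff' hBm).1 hzero] with x hx hxB
    simpa using hx hxB
  obtain ⟨n, hn⟩ : ∃ n : ℕ, 0 < μ (Metric.ball x₀ n \ Ω) := by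
    by_contra! hcon
    refine hΩc.ne' (measure_mono_null ?_ (measure_iUnion_null fun n => le_zero_iff.1 (hcon n)))
    intro x hx
    obtain ⟨n, hn⟩ := exists_nat_gt (dist x x₀)
    exact mem_iUnion.2 ⟨n, hn, hx⟩
  have hall : ∀ k : ℕ, ∀ᵐ x ∂μ, x ∈ Metric.ball x₀ ((n : ℝ) + k + 1) → w x = 0 := fun k =>
    hball _ (by positivity) (hn.trans_le (measure_mono (sdiff_subset_sdiff_left
      (Metric.ball_subset_ball (by linarith [Nat.cast_nonneg (α := ℝ) k])))))
  filter_upwards [ae_all_iff.2 hall] with x hx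
  obtain ⟨k, hk⟩ := exists_nat_gt (dist x x₀)
  exact hx k (Metric.mem_ball.2 (by linarith [Nat.cast_nonneg (α := ℝ) n]))

end LeastGradient

/-! ### The maximum principle -/

open LeastGradient in
theorem theorem5p1 {X : Type*} [MetricSpace X] [CompleteSpace X] [MeasurableSpace X]
    [BorelSpace X] (μ : Measure X) (hdoubling : LeastGradient.IsDoubling μ)
    (hpoincare : LeastGradient.SupportsPoincare μ)
    (M : ℝ) (f : X → ℝ) (hf : LeastGradient.MemBV μ f) (hfM : ∀ᵐ x ∂μ, f x ≤ M)
    (Ω : Set X) (hΩ_open : IsOpen Ω) (hΩ_conn : IsConnected Ω) (hΩ_compl : 0 < μ Ωᶜ)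
    (u : X → ℝ) (hu : LeastGradient.IsDirichletSolution μ Ω f u) :
    ∀ᵐ x ∂μ, x ∈ Ω → u x ≤ M := by
  obtain ⟨⟨huint, huvar⟩, ⟨⟨hufint, -⟩, huf⟩, hmin⟩ := hu
  set w : X → ℝ := fun x => max (u x - M) 0 with hw
  have hwm : AEMeasurable w μ := (huint.aemeasurable.sub_const M).max aemeasurable_const
  have hw0 : ∀ᵐ x ∂μ, x ∉ Ω → w x = 0 := by
    filter_upwards [huf, hfM] with x h1 h2 hx
    exact max_eq_right (by linarith [h1 hx])
  -- Constants need not be integrable, so `w` is compared with `u - f`: from `f ≤ M` follows `0 ≤ w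
  -- ≤ |u - f|`.
  have hwint : Integrable w μ := by
    refine hufint.mono hwm.aestronglyMeasurable ?_
    filter_upwards [hfM] with x hx
    rw [Real.norm_eq_abs, Real.norm_eq_abs, abs_of_nonneg (le_max_right _ _)]
    exact max_le ((sub_le_sub_left hx _).trans (le_abs_self _)) (abs_nonneg _)
  have hwvar : variation μ w univ < ∞ :=
    (le_add_self.trans (variation_min_add_max_le hdoubling u univ M)).trans_lt huvar
  have hneg : MemBVZero μ (fun x => -w x) Ω :=
    ⟨⟨hwint.neg, (variation_neg_le w univ).trans_lt hwvar⟩, hw0.mono fun x hx hxΩ => by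
      simpa using hx hxΩ⟩
  have hle := hmin _ hneg
  have heq : (fun x => u x + -w x) = fun x => min (u x) M := by
    funext x
    simp only [hw]
    rcases le_total (u x) M with h | h
    · rw [max_eq_right (by linarith), min_eq_left h]; ring
    · rw [max_eq_left (by linarith), min_eq_right h]; ring
  rw [heq] at hle
  have hsum := variation_min_add_max_le hdoubling u (closure Ω) M
  have hfin : variation μ (fun x => min (u x) M) (closure Ω) ≠ ∞ :=
    ((le_self_add.trans hsum).trans_lt ((variation_mono (subset_univ _)).trans_lt huvar)).ne
  -- Splitting and minimality leave `‖D min(u, M)‖ + ‖Dw‖ ≤ ‖D min(u, M)‖` on the closure, and the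
  -- common term is finite.
  have hzero : variation μ w (closure Ω) = 0 := by
    have h1 := hsum.trans hle
    rw [← add_zero (variation μ (fun x => min (u x) M) (closure Ω)), add_assoc, zero_add] at h1
    exact le_zero_iff.1 ((ENNReal.add_le_add_iff_left hfin).1 h1)
  filter_upwards [ae_eq_zero_of_variation_closure_eq_zero hdoubling hpoincare hwm hΩ_open
    hΩ_conn.nonempty hΩ_compl hw0 hzero] with x hx _
  have : u x - M ≤ w x := le_max_left _ _
  linarith
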